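/- Let $A=(a_1,\dots,a_m)$ be a finite multiset of integers $a_i\ge 2$. For $n\in\mathbb N$ let $\mathcal C(A)\subseteq S_n$ be the extended conjugacy class of $A$, i.e. the set of permutations in $S_n$ whose nontrivial cycles, in the disjoint cycle decomposition, have lengths exactly $a_1,\dots,a_m$ (with multiplicity). Put $|A|=m$ and $c(A)=\sum_{i=1}^m(a_i-1)$, and let $f(A,n)$ be the infimum of $|G|$ over all subsets $G\subseteq\mathcal C(A)$ that generate $S_n$ ($f(A,n)=\infty$ if there is none). Call $A$ odd if the permutations in its extended conjugacy classes are odd (equivalently, if $c(A)$ is odd). Write $(k)$ for the multiset with the single element $k$, $B_k=(2,2,\dots,2)$ for the multiset of $k$ twos, and $\Phi_j$ for the $j$th cyclotomic polynomial. Then there is a function $X_0$ from multisets to nonnegative integers such that, for every odd $A$, $$f(A,n)=\left\lceil\frac{n-1}{c(A)}\right\rceil\qquad\text{for all } n\ge X_0(A),$$ and moreover 1. $X_0((k))\le 2k-1$ whenever $(k)$ is odd (that is, $k\geq 2$ is even); 2. $X_0(B_k)\le\binom{2k+1}{2}+1$ whenever $B_k$ is odd (that is, $k$ is odd); 3. $X_0(A)\le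 c(A)\,\Phi_{2|A|}(2|A|)+1$ for every odd $A$. -/

import Mathlib

namespace ConjGen

/-- The extended conjugacy class `𝒞(A)` in `S_n`: all permutations of `n` points whose nontrivial
cycles in the disjoint cycle decomposition have lengths exactly the multiset `A`. -/
def extClass (A : Multiset ℕ) (n : ℕ) : Set (Equiv.Perm (Fin n)) :=
  {σ | σ.cycleType = A}

/-- `c(A) = ∑ (a_i - 1)`, only used when all `a_i ≥ 2`. -/
def c (A : Multiset ℕ) : ℕ :=
  (A.map (fun a => a - 1)).sum

/-- `f(A, n)`: the infimum of `|G|` over all `G ⊆ 𝒞(A)` that generate `S_n`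
(it is `⊤` if there is no such `G`). -/
noncomputable def f (A : Multiset ℕ) (n : ℕ) : ℕ∞ :=
  ⨅ G ∈ {G : Set (Equiv.Perm (Fin n)) | G ⊆ extClass A n ∧ Subgroup.closure G = ⊤}, G.encard

/-- `A` is a multiset of cycle lengths (all `≥ 2`) whose extended conjugacy class consists of odd
permutations, whatever the number of points. -/
def IsOddType (A : Multiset ℕ) : Prop :=
  (∀ a ∈ A, 2 ≤ a) ∧ ∀ (n : ℕ), ∀ σ ∈ extClass A n, Equiv.Perm.sign σ = -1

/-- `B_k = (2, 2, …, 2)` with `k` twos. -/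
def B (k : ℕ) : Multiset ℕ :=
  Multiset.replicate k 2

end ConjGen

/-! The threshold `2 * |A| * c(A) + 1` works for every odd `A`, and the three bounds follow from it.

Lower bound: replacing each `a`-cycle by a path with `a - 1` edges turns `d` generators into a graph
with at most `d * c(A)` edges. It is connected if they generate `S_n`, so `n ≤ d * c(A) + 1`
(`card_le_of_closure_eq_top`).

Upper bound (`exists_generating_set`): take `max 2 |A|` permutations of type `A` whose supports meet
pairwise only in a point `x`. The commutator of two of them is a three-cycle, and every nontrivial
block through `x` is stable under all of them. Each further permutation fixes a point of the orbit
of `x`, which keeps blocks stable, and absorbs up to `c(A)` other orbits. Once the group is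
transitive it is primitive, so by Jordan's theorem it contains `A_n`; an odd generator gives `S_n`.
-/

namespace ConjGen

open Equiv Equiv.Perm

/-! ### Orbits and sets of orbit representatives -/

section Linked

variable {α : Type*}

lemma perm_apply_inv_self (σ : Perm α) (x : α) : σ (σ⁻¹ x) = x :=
  σ.apply_symm_apply x

lemma perm_inv_apply_self (σ : Perm α) (x : α) : σ⁻¹ (σ x) = x :=
  σ.symm_apply_apply x

/-- Two points lie in the same orbit of the group generated by `S`. -/
def Linked (S : Set (Perm α)) (x y : α) : Prop :=
  ∃ g ∈ Subgroup.closure S, g x = y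

lemma Linked.refl (S : Set (Perm α)) (x : α) : Linked S x x :=
  ⟨1, one_mem _, rfl⟩

lemma Linked.trans {S : Set (Perm α)} {x y z : α} (h₁ : Linked S x y) (h₂ : Linked S y z) :
    Linked S x z := by
  obtain ⟨g, hg, rfl⟩ := h₁
  obtain ⟨h, hh, rfl⟩ := h₂
  exact ⟨h * g, mul_mem hh hg, rfl⟩

lemma Linked.symm {S : Set (Perm α)} {x y : α} (h : Linked S x y) : Linked S y x := by
  obtain ⟨g, hg, rfl⟩ := h
  exact ⟨g⁻¹, inv_mem hg, by simp⟩

lemma Linked.mono {S S' : Set (Perm α)} (hS : S ⊆ S') {x y : α} (h : Linked S x y) :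
    Linked S' x y := by
  obtain ⟨g, hg, rfl⟩ := h
  exact ⟨g, Subgroup.closure_mono hS hg, rfl⟩

lemma Linked.of_sameCycle {S : Set (Perm α)} {σ : Perm α} (hσ : σ ∈ S) {x y : α}
    (h : σ.SameCycle x y) : Linked S x y := by
  obtain ⟨i, rfl⟩ := h
  exact ⟨σ ^ i, zpow_mem (Subgroup.subset_closure hσ) i, rfl⟩

/-- Every point lies in the orbit of some point of `W`. -/
def Covers (S : Set (Perm α)) (W : Finset α) : Prop :=
  ∀ y, ∃ w ∈ W, Linked S w y

/-- The points of `T` become redundant because a cycle of `σ` ties each of them to an orbit still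
represented in `W \ T`. -/
lemma Covers.insert_sdiff [DecidableEq α] {S : Set (Perm α)} {W T : Finset α}
    (h : Covers S W) (σ : Perm α)
    (hT : ∀ t ∈ T, ∃ r, σ.SameCycle r t ∧ ∃ w ∈ W \ T, Linked S w r) :
    Covers (insert σ S) (W \ T) := by
  intro y
  obtain ⟨w, hw, hwy⟩ := h y
  by_cases hwT : w ∈ T
  · obtain ⟨r, hr, v, hv, hvr⟩ := hT w hwT
    exact ⟨v, hv, (hvr.mono (Set.subset_insert _ _)).trans
      ((Linked.of_sameCycle (Set.mem_insert _ _) hr).trans (hwy.mono (Set.subset_insert _ _)))⟩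
  · exact ⟨w, Finset.mem_sdiff.2 ⟨hw, hwT⟩, hwy.mono (Set.subset_insert _ _)⟩

end Linked

/-! ### Blocks, three-cycles and primitivity -/

section Blocks

variable {α : Type*}

/-- The part of the block property of `B` that is used below: an element of the group
that maps one point of `B` into `B` maps `B` into itself. -/
def BlockFor (S : Set (Perm α)) (B : Set α) : Prop :=
  ∀ g ∈ Subgroup.closure S, ∀ b ∈ B, g b ∈ B → ∀ b' ∈ B, g b' ∈ B

lemma BlockFor.mono {S S' : Set (Perm α)} (hS : S ⊆ S') {B : Set α} (h : BlockFor S' B) :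
    BlockFor S B :=
  fun g hg => h g (Subgroup.closure_mono hS hg)

/-- Every nontrivial block that contains `x` is stable under the generators in `S`. -/
def StabilizesBlocks (S : Set (Perm α)) (x : α) : Prop :=
  ∀ B : Set α, x ∈ B → (∃ y ∈ B, y ≠ x) → BlockFor S B → ∀ σ ∈ S, ∀ b ∈ B, σ b ∈ B

lemma BlockFor.mem_of_linked {S : Set (Perm α)} {x y : α} {B : Set α} (hB : BlockFor S B)
    (hS : ∀ σ ∈ S, ∀ b ∈ B, σ b ∈ B) (hx : x ∈ B) (hxy : Linked S x y) : y ∈ B := by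
  obtain ⟨g, hg, rfl⟩ := hxy
  have key : ∀ b ∈ B, g b ∈ B := by
    refine Subgroup.closure_induction (p := fun g _ => ∀ b ∈ B, g b ∈ B) hS (fun b hb => hb)
      (fun a b _ _ ha hb c hc => ha _ (hb _ hc)) (fun a ha h b hb => ?_) hg
    -- For inverses, the block property applies because `a⁻¹` sends `a b ∈ B` back to `b ∈ B`.
    exact hB a⁻¹ (inv_mem ha) (a b) (h b hb) (by simpa using hb) b hb
  exact key x hx

/-- A block stable under `S` contains the whole orbit of `x`, hence `z`; since `σ` fixes `z`, it
maps the block into itself. -/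
lemma StabilizesBlocks.insert {S : Set (Perm α)} {x : α} (h : StabilizesBlocks S x)
    {σ : Perm α} {z : α} (hz : Linked S x z) (hσ : σ z = z) :
    StabilizesBlocks (insert σ S) x := by
  intro B hx hy hB τ hτ
  have hB' := hB.mono (Set.subset_insert σ S)
  have hS := h B hx hy hB'
  rcases Set.mem_insert_iff.1 hτ with rfl | hτ
  · have hzB := hB'.mem_of_linked hS hx hz
    exact hB τ (Subgroup.subset_closure (Set.mem_insert _ _)) z hzB (by rwa [hσ])
  · exact hS τ hτ

lemma commutator_eq_swap_mul_swap [DecidableEq α] {σ τ : Perm α} {x : α}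
    (h : ∀ p, p ≠ x → σ p = p ∨ τ p = p) (hσ : σ x ≠ x) (hτ : τ x ≠ x) :
    σ * τ * σ⁻¹ * τ⁻¹ = swap x (τ x) * swap x (σ x) := by
  have h₁ : τ (σ x) = σ x := (h (σ x) hσ).resolve_left fun e => hσ (σ.injective e)
  have h₂ : σ (τ x) = τ x := (h (τ x) hτ).resolve_right fun e => hτ (τ.injective e)
  have h₃ : τ (σ⁻¹ x) = σ⁻¹ x := by
    refine (h (σ⁻¹ x) fun e => hσ ?_).resolve_left fun e => hσ ?_
    · rw [Perm.inv_eq_iff_eq] at e; exact e.symm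
    · simp only [perm_apply_inv_self] at e
      rw [eq_comm, Perm.inv_eq_iff_eq] at e; exact e.symm
  have h₄ : σ (τ⁻¹ x) = τ⁻¹ x := by
    refine (h (τ⁻¹ x) fun e => hτ ?_).resolve_right fun e => hτ ?_
    · rw [Perm.inv_eq_iff_eq] at e; exact e.symm
    · simp only [perm_apply_inv_self] at e
      rw [eq_comm, Perm.inv_eq_iff_eq] at e; exact e.symm
  have hne : σ x ≠ τ x := fun e => hσ (σ.injective (by rw [e, h₂]))
  ext p
  simp only [Perm.mul_apply]
  by_cases hp : p = x
  · subst hp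
    rw [swap_apply_left, swap_apply_of_ne_of_ne hσ hne]
    rw [show σ⁻¹ (τ⁻¹ p) = τ⁻¹ p from (Perm.inv_eq_iff_eq).2 h₄.symm, perm_apply_inv_self]
  by_cases hpσ : p = σ x
  · subst hpσ
    rw [swap_apply_right, swap_apply_left, show τ⁻¹ (σ x) = σ x from
      (Perm.inv_eq_iff_eq).2 h₁.symm, perm_inv_apply_self, h₂]
  by_cases hpτ : p = τ x
  · subst hpτ
    rw [swap_apply_of_ne_of_ne hp hpσ, swap_apply_right, perm_inv_apply_self, h₃,
      perm_apply_inv_self]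
  rw [swap_apply_of_ne_of_ne hp hpσ, swap_apply_of_ne_of_ne hp hpτ]
  rcases h p hp with hf | hf
  · have h₅ : σ (τ⁻¹ p) = τ⁻¹ p := by
      by_cases hq : τ p = p
      · rw [show τ⁻¹ p = p from (Perm.inv_eq_iff_eq).2 hq.symm, hf]
      · refine (h _ fun e => hpτ ((Perm.inv_eq_iff_eq).1 e)).resolve_right fun e => hq ?_
        rw [perm_apply_inv_self, eq_comm, Perm.inv_eq_iff_eq] at e
        exact e.symm
    rw [show σ⁻¹ (τ⁻¹ p) = τ⁻¹ p from (Perm.inv_eq_iff_eq).2 h₅.symm, perm_apply_inv_self, hf]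
  · rw [show τ⁻¹ p = p from (Perm.inv_eq_iff_eq).2 hf.symm]
    have h₅ : τ (σ⁻¹ p) = σ⁻¹ p := by
      by_cases hq : σ p = p
      · rw [show σ⁻¹ p = p from (Perm.inv_eq_iff_eq).2 hq.symm, hf]
      · refine (h _ fun e => hpσ ((Perm.inv_eq_iff_eq).1 e)).resolve_left fun e => hq ?_
        rw [perm_apply_inv_self, eq_comm, Perm.inv_eq_iff_eq] at e
        exact e.symm
    rw [h₅, perm_apply_inv_self]

/-- The commutator `ρ` is the cycle `x → σ x → τ x → x`. Any second point of the block forces `σ x`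
and `τ x` into it; `σ` fixes `τ x` and `τ` fixes `σ x`, so both preserve the block. -/
lemma stabilizesBlocks_pair {σ τ : Perm α} {x : α}
    (h : ∀ p, p ≠ x → σ p = p ∨ τ p = p) (hσ : σ x ≠ x) (hτ : τ x ≠ x) :
    StabilizesBlocks {σ, τ} x := by
  classical
  intro B hx ⟨y, hy, hyx⟩ hB
  have mσ : σ ∈ Subgroup.closure {σ, τ} := Subgroup.subset_closure (by simp)
  have mτ : τ ∈ Subgroup.closure {σ, τ} := Subgroup.subset_closure (by simp)
  have h₁ : τ (σ x) = σ x := (h (σ x) hσ).resolve_left fun e => hσ (σ.injective e)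
  have h₂ : σ (τ x) = τ x := (h (τ x) hτ).resolve_right fun e => hτ (τ.injective e)
  have hne : σ x ≠ τ x := fun e => hσ (σ.injective (by rw [e, h₂]))
  have hρ := commutator_eq_swap_mul_swap h hσ hτ
  have mρ : swap x (τ x) * swap x (σ x) ∈ Subgroup.closure {σ, τ} := by
    rw [← hρ]
    exact mul_mem (mul_mem (mul_mem mσ mτ) (inv_mem mσ)) (inv_mem mτ)
  set ρ := swap x (τ x) * swap x (σ x) with hρ'
  have e₁ : ρ x = σ x := by simp [hρ', swap_apply_of_ne_of_ne hσ hne]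
  have e₂ : ρ (σ x) = τ x := by simp [hρ']
  have e₃ : ρ (τ x) = x := by simp [hρ', swap_apply_of_ne_of_ne hτ hne.symm]
  have hσB : σ x ∈ B := by
    by_cases hyσ : y = σ x
    · exact hyσ ▸ hy
    by_cases hyτ : y = τ x
    · rw [← e₁]
      exact hB ρ mρ (τ x) (hyτ ▸ hy) (by rwa [e₃]) x hx
    · rw [← e₁]
      -- Here `y` is off the three-cycle, so `ρ` fixes it and preserves the block.
      refine hB ρ mρ y hy ?_ x hx
      rwa [hρ', Perm.mul_apply, swap_apply_of_ne_of_ne hyx hyσ, swap_apply_of_ne_of_ne hyx hyτ]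
  have hτB : τ x ∈ B := by
    rw [← e₂]
    exact hB ρ mρ x hx (by rwa [e₁]) _ hσB
  intro g hg
  rcases hg with rfl | rfl
  · exact hB _ mσ _ hτB (by rwa [h₂])
  · exact hB _ mτ _ hσB (by rwa [h₁])

lemma exists_isThreeCycle_mem_closure_pair [Fintype α] [DecidableEq α] {σ τ : Perm α} {x : α}
    (h : ∀ p, p ≠ x → σ p = p ∨ τ p = p) (hσ : σ x ≠ x) (hτ : τ x ≠ x) :
    ∃ ρ ∈ Subgroup.closure {σ, τ}, ρ.IsThreeCycle := by
  have mσ : σ ∈ Subgroup.closure {σ, τ} := Subgroup.subset_closure (by simp)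
  have mτ : τ ∈ Subgroup.closure {σ, τ} := Subgroup.subset_closure (by simp)
  have h₂ : σ (τ x) = τ x := (h (τ x) hτ).resolve_right fun e => hτ (τ.injective e)
  have hne : σ x ≠ τ x := fun e => hσ (σ.injective (by rw [e, h₂]))
  refine ⟨_, mul_mem (mul_mem (mul_mem mσ mτ) (inv_mem mσ)) (inv_mem mτ), ?_⟩
  rw [commutator_eq_swap_mul_swap h hσ hτ]
  exact isThreeCycle_swap_mul_swap_same hτ.symm hσ.symm hne.symm

/-- A group of permutations that contains a three-cycle and an odd permutation is the whole
symmetric group as soon as it is transitive and its nontrivial blocks are stable. -/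
lemma closure_eq_top [Fintype α] [DecidableEq α] {S : Set (Perm α)} {x : α}
    (hlink : ∀ y, Linked S x y) (hS : StabilizesBlocks S x)
    (h3 : ∃ ρ ∈ Subgroup.closure S, ρ.IsThreeCycle)
    (hodd : ∃ σ ∈ S, sign σ = -1) : Subgroup.closure S = ⊤ := by
  have htrans : MulAction.IsPretransitive (Subgroup.closure S) α := by
    refine ⟨fun a b => ?_⟩
    obtain ⟨g, hg, hgb⟩ := (hlink a).symm.trans (hlink b)
    exact ⟨⟨g, hg⟩, hgb⟩
  have hprim : MulAction.IsPreprimitive (Subgroup.closure S) α := by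
    refine MulAction.IsPreprimitive.of_isTrivialBlock_base x fun {B} hx hB => ?_
    have hB' : BlockFor S B := by
      intro g hg b hb hgb b' hb'
      have := hB.smul_eq_of_mem (g := (⟨g, hg⟩ : Subgroup.closure S)) hb hgb
      rw [← this]
      exact Set.smul_mem_smul_set hb'
    by_cases hy : ∃ y ∈ B, y ≠ x
    · right
      exact Set.eq_univ_of_forall fun y =>
        hB'.mem_of_linked (hS B hx hy hB') hx (hlink y)
    · left
      push Not at hy
      intro a ha b hb
      rw [hy a ha, hy b hb]
  obtain ⟨ρ, hρ, hρ3⟩ := h3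
  have halt := alternatingGroup_le_of_isPreprimitive_of_isThreeCycle_mem hprim hρ3 hρ
  obtain ⟨σ, hσ, hsign⟩ := hodd
  have mσ := Subgroup.subset_closure hσ
  rw [eq_top_iff]
  intro g _
  rcases Int.units_eq_one_or (sign g) with hg | hg
  · exact halt (mem_alternatingGroup.2 hg)
  · have : g * σ⁻¹ ∈ Subgroup.closure S :=
      halt (mem_alternatingGroup.2 (by simp [hg, hsign]))
    simpa using mul_mem this mσ

end Blocks

/-! ### Permutations with prescribed cycle type and support -/

section Construction

variable {α : Type*} [Fintype α] [DecidableEq α]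

lemma exists_isCycle_support_eq {r : α} {T : Finset α} (hr : r ∉ T) (hT : T.Nonempty) :
    ∃ σ : Perm α, σ.IsCycle ∧ σ.support = insert r T := by
  have hnd : (r :: T.toList).Nodup := by simp [hr, T.nodup_toList]
  have hlen : 2 ≤ (r :: T.toList).length := by
    have := hT.card_pos
    simp only [List.length_cons, Finset.length_toList]
    omega
  refine ⟨(r :: T.toList).formPerm, List.isCycle_formPerm hnd hlen, ?_⟩
  rw [List.support_formPerm_of_nodup _ hnd]
  · ext; simp
  · rintro x hx
    rw [hx] at hlen
    simp at hlen

lemma c_cons (a : ℕ) (A : Multiset ℕ) : c (a ::ₘ A) = (a - 1) + c A := by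
  simp [c]

lemma card_le_c {A : Multiset ℕ} (hA : ∀ a ∈ A, 2 ≤ a) : A.card ≤ c A := by
  induction A using Multiset.induction with
  | empty => simp
  | cons a A ih =>
    have h₁ := hA a (by simp)
    have h₂ := ih fun b hb => hA b (by simp [hb])
    rw [c_cons, Multiset.card_cons]
    omega

/-- `R` supplies one point for each cycle and `T` the remaining `a - 1` points of each. -/
lemma exists_cycleType_eq {A : Multiset ℕ} (hA : ∀ a ∈ A, 2 ≤ a) :
    ∀ {R T : Finset α}, Disjoint R T → R.card = A.card → T.card = c A →
    ∃ σ : Perm α, σ.cycleType = A ∧ σ.support = R ∪ T ∧ ∀ t ∈ T, ∃ r ∈ R, σ.SameCycle r t := by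
  induction A using Multiset.induction with
  | empty =>
    intro R T _ hR hT
    have hR' : R = ∅ := by simpa using hR
    have hT' : T = ∅ := by simpa [c] using hT
    exact ⟨1, by simp [hR', hT']⟩
  | cons a A ih =>
    intro R T hd hR hT
    rw [Multiset.card_cons] at hR
    rw [c_cons] at hT
    have ha := hA a (by simp)
    obtain ⟨r, hr⟩ : R.Nonempty := by rw [← Finset.card_pos]; omega
    obtain ⟨T₁, hT₁, hc₁⟩ := Finset.exists_subset_card_eq (s := T) (n := a - 1) (by omega)
    obtain ⟨σ₁, hσ₁, hs₁⟩ := exists_isCycle_support_eq (r := r) (T := T₁)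
      (fun h => Finset.disjoint_left.1 hd hr (hT₁ h)) (by rw [← Finset.card_pos]; omega)
    have hrT₁ : r ∉ T₁ := fun h => Finset.disjoint_left.1 hd hr (hT₁ h)
    obtain ⟨σ₂, hσ₂, hs₂, hl₂⟩ := ih (fun b hb => hA b (by simp [hb])) (R := R.erase r)
      (T := T \ T₁)
      (hd.mono (Finset.erase_subset _ _) Finset.sdiff_subset)
      (by rw [Finset.card_erase_of_mem hr]; omega)
      (by rw [Finset.card_sdiff_of_subset hT₁]; omega)
    have hdisj : σ₁.Disjoint σ₂ := by
      rw [disjoint_iff_disjoint_support, hs₁, hs₂, Finset.disjoint_left]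
      intro y hy hy'
      simp only [Finset.mem_insert, Finset.mem_union, Finset.mem_erase, Finset.mem_sdiff] at hy hy'
      rcases hy with rfl | hy
      · rcases hy' with h | h
        · exact h.1 rfl
        · exact Finset.disjoint_left.1 hd hr h.1
      · rcases hy' with h | h
        · exact Finset.disjoint_left.1 hd h.2 (hT₁ hy)
        · exact h.2 hy
    refine ⟨σ₁ * σ₂, ?_, ?_, ?_⟩
    · rw [hdisj.cycleType_mul, hσ₁.cycleType, hs₁, hσ₂, Finset.card_insert_of_notMem hrT₁, hc₁,
        Nat.sub_add_cancel (by omega), Multiset.singleton_add]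
    · rw [hdisj.support_mul, hs₁, hs₂]
      ext y
      simp only [Finset.mem_insert, Finset.mem_union, Finset.mem_erase, Finset.mem_sdiff]
      have : y ∈ T₁ → y ∈ T := fun h => hT₁ h
      by_cases hy : y = r
      · subst hy; simp [hr]
      · by_cases hy₁ : y ∈ T₁ <;> simp_all
    · intro t ht
      by_cases ht₁ : t ∈ T₁
      · refine ⟨r, hr, ?_⟩
        obtain ⟨i, hi⟩ := hσ₁.sameCycle (x := r) (y := t)
          (by rw [← mem_support, hs₁]; simp) (by rw [← mem_support, hs₁]; simp [ht₁])
        refine ⟨i, ?_⟩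
        rw [hdisj.commute.mul_zpow, Perm.mul_apply]
        have : (σ₂ ^ i) r = r := by
          refine zpow_apply_eq_self_of_apply_eq_self ?_ i
          refine (hdisj r).resolve_left ?_
          rw [← Ne, ← mem_support, hs₁]; simp
        rw [this, hi]
      · obtain ⟨s, hs, i, hi⟩ := hl₂ t (Finset.mem_sdiff.2 ⟨ht, ht₁⟩)
        refine ⟨s, Finset.mem_of_mem_erase hs, i, ?_⟩
        rw [hdisj.commute.mul_zpow, Perm.mul_apply, hi]
        refine zpow_apply_eq_self_of_apply_eq_self ?_ i
        refine (hdisj t).resolve_right ?_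
        rw [← Ne, ← mem_support, hs₂]; simp [ht, ht₁]

end Construction

/-! ### Upper bound: building a small generating set -/

section UpperBound

variable {α : Type*} [Fintype α] [DecidableEq α]

/-- A set of `i` permutations of type `A` through the common point `x`, whose supports are
contained in the small set `U`; `W` covers all orbits. -/
structure Flower (A : Multiset ℕ) (x : α) (i : ℕ) (S : Set (Perm α)) (U W O : Finset α) :
    Prop where
  encard_le : S.encard ≤ i
  cycleType_eq : ∀ σ ∈ S, σ.cycleType = A
  mem_U : x ∈ U
  card_U : U.card + i ≤ 1 + i * (c A + A.card)
  apply_eq : ∀ σ ∈ S, ∀ y ∉ U, σ y = y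
  compl_subset : Uᶜ ⊆ W
  mem_W : x ∈ W
  card_W : W.card + i * c A ≤ Fintype.card α
  covers : Covers S W
  card_O : i + 1 ≤ O.card
  subset_U : O ⊆ U
  linked : ∀ o ∈ O, Linked S x o

lemma Flower.empty (A : Multiset ℕ) (x : α) : Flower A x 0 ∅ {x} Finset.univ {x} where
  encard_le := by simp
  cycleType_eq := by simp
  mem_U := by simp
  card_U := by simp
  apply_eq := by simp
  compl_subset := by simp
  mem_W := by simp
  card_W := by simp
  covers := fun y => ⟨y, by simp, Linked.refl _ _⟩
  card_O := by simp
  subset_U := by simp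
  linked := by simp [Linked.refl]

/-- The new petal uses `x` and `c A + A.card - 1` fresh points outside `U`. All fresh points are
still in `W`, so exactly `c A` representatives can be dropped; `σ x` is a new point of the orbit of
`x`. -/
lemma Flower.step {A : Multiset ℕ} (hA : ∀ a ∈ A, 2 ≤ a) (hA0 : A ≠ 0) {x : α} {i : ℕ}
    {S : Set (Perm α)} {U W O : Finset α} (h : Flower A x i S U W O)
    (hn : (i + 1) * (c A + A.card) ≤ Fintype.card α + i) :
    ∃ σ U' W' O', Flower A x (i + 1) (insert σ S) U' W' O' ∧ σ x ≠ x ∧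
      ∀ u ∈ U, u ≠ x → σ u = u := by
  have hm : 0 < A.card := Multiset.card_pos.2 hA0
  have hU := h.card_U
  have hUc : Uᶜ.card = Fintype.card α - U.card := Finset.card_compl U
  have hUle : U.card ≤ Fintype.card α := Finset.card_le_univ U
  rw [add_mul, one_mul] at hn
  obtain ⟨T, hTU, hT⟩ := Finset.exists_subset_card_eq (s := Uᶜ) (n := c A) (by omega)
  obtain ⟨F, hFU, hF⟩ := Finset.exists_subset_card_eq (s := Uᶜ \ T) (n := A.card - 1)
    (by rw [Finset.card_sdiff_of_subset hTU]; omega)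
  have hxF : x ∉ F := fun hx => by
    have := hFU hx
    simp [h.mem_U] at this
  have hFU' : ∀ y ∈ F, y ∉ U ∧ y ∉ T := fun y hy => by
    have := hFU hy
    simpa using this
  have hTU' : ∀ y ∈ T, y ∉ U := fun y hy => by
    have := hTU hy
    simpa using this
  have hxT : x ∉ T := fun hx => hTU' x hx h.mem_U
  obtain ⟨σ, hσ, hs, hl⟩ := exists_cycleType_eq hA (R := insert x F) (T := T) (by
      rw [Finset.disjoint_insert_left]
      exact ⟨hxT, Finset.disjoint_left.2 fun y hy => (hFU' y hy).2⟩)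
    (by rw [Finset.card_insert_of_notMem hxF]; omega) hT
  have hσx : σ x ≠ x := by rw [← mem_support, hs]; simp
  have hσU : ∀ u ∈ U, u ≠ x → σ u = u := by
    intro u hu hux
    by_contra hne
    rw [← Ne, ← mem_support, hs] at hne
    simp only [Finset.mem_union, Finset.mem_insert] at hne
    rcases hne with (e | e) | e
    · exact hux e
    · exact (hFU' u e).1 hu
    · exact hTU' u e hu
  have hTW : T ⊆ W := hTU.trans h.compl_subset
  have hσxU : σ x ∉ U := fun hu => hσx (σ.injective (hσU _ hu hσx))
  have hsub : ∀ y, y ∉ U ∪ (F ∪ T) → σ y = y := by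
    intro y hy
    by_contra hne
    rw [← Ne, ← mem_support, hs] at hne
    simp only [Finset.mem_union, Finset.mem_insert] at hne hy
    rcases hne with (rfl | e) | e
    · exact hy (Or.inl h.mem_U)
    · exact hy (Or.inr (Or.inl e))
    · exact hy (Or.inr (Or.inr e))
  refine ⟨σ, U ∪ (F ∪ T), W \ T, insert (σ x) O, ⟨?_, ?_, ?_, ?_, ?_, ?_, ?_, ?_, ?_, ?_, ?_, ?_⟩,
    hσx, hσU⟩
  · push_cast
    exact (Set.encard_insert_le _ _).trans (add_le_add_left h.encard_le 1)
  · rintro τ (rfl | hτ)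
    · exact hσ
    · exact h.cycleType_eq τ hτ
  · simp [h.mem_U]
  · have h₁ := Finset.card_union_le U (F ∪ T)
    have h₂ := Finset.card_union_le F T
    rw [add_mul, one_mul]
    omega
  · rintro τ (rfl | hτ) y hy
    · exact hsub y hy
    · exact h.apply_eq τ hτ y fun hu => hy (Finset.mem_union_left _ hu)
  · intro y hy
    simp only [Finset.mem_compl, Finset.mem_union, not_or] at hy
    exact Finset.mem_sdiff.2 ⟨h.compl_subset (Finset.mem_compl.2 hy.1), hy.2.2⟩
  · exact Finset.mem_sdiff.2 ⟨h.mem_W, hxT⟩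
  · have h₁ := Finset.card_le_card hTW
    have h₂ := h.card_W
    rw [Finset.card_sdiff_of_subset hTW, add_mul, one_mul]
    omega
  · refine h.covers.insert_sdiff σ fun t ht => ?_
    obtain ⟨r, hr, hrt⟩ := hl t ht
    refine ⟨r, hrt, r, ?_, Linked.refl _ _⟩
    rcases Finset.mem_insert.1 hr with rfl | hr
    · exact Finset.mem_sdiff.2 ⟨h.mem_W, hxT⟩
    · exact Finset.mem_sdiff.2
        ⟨h.compl_subset (Finset.mem_compl.2 (hFU' r hr).1), (hFU' r hr).2⟩
  · have h₁ := h.card_O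
    rw [Finset.card_insert_of_notMem fun ho => hσxU (h.subset_U ho)]
    omega
  · intro y hy
    rcases Finset.mem_insert.1 hy with rfl | hy
    · by_contra hne
      have h₁ := hsub _ hne
      exact hσx (σ.injective h₁)
    · exact Finset.mem_union_left _ (h.subset_U hy)
  · intro y hy
    rcases Finset.mem_insert.1 hy with rfl | hy
    · exact Linked.of_sameCycle (Set.mem_insert _ _) ⟨1, by simp⟩
    · exact (h.linked y hy).mono (Set.subset_insert _ _)

lemma exists_flower {A : Multiset ℕ} (hA : ∀ a ∈ A, 2 ≤ a) (hA0 : A ≠ 0) (x : α) {k : ℕ}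
    (hk : 2 ≤ k) (hn : k * (c A + A.card) + 1 ≤ Fintype.card α + k) :
    ∃ S U W O, Flower A x k S U W O ∧ StabilizesBlocks S x ∧
      ∃ ρ ∈ Subgroup.closure S, ρ.IsThreeCycle := by
  have hm : 0 < A.card := Multiset.card_pos.2 hA0
  have hm' := card_le_c hA
  have mono : ∀ i, i < k → (i + 1) * (c A + A.card) ≤ Fintype.card α + i := by
    intro i hi
    obtain ⟨j, rfl⟩ := Nat.exists_eq_add_of_lt hi
    obtain ⟨s, hs⟩ : ∃ s, c A + A.card = s + 1 := ⟨c A + A.card - 1, by omega⟩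
    rw [hs] at hn ⊢
    nlinarith [Nat.zero_le (j * s)]
  induction k, hk using Nat.le_induction with
  | base =>
    obtain ⟨σ, U, W, O, h₁, hσx, -⟩ := (Flower.empty A x).step hA hA0 (mono 0 (by omega))
    obtain ⟨τ, U', W', O', h₂, hτx, hτ⟩ := h₁.step hA hA0 (mono 1 (by omega))
    have hst : ∀ p, p ≠ x → τ p = p ∨ σ p = p := fun p hp => by
      by_cases hpU : p ∈ U
      · exact Or.inl (hτ p hpU hp)
      · exact Or.inr (h₁.apply_eq σ (by simp) p hpU)
    simp only [insert_empty_eq] at h₂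
    exact ⟨_, U', W', O', h₂, stabilizesBlocks_pair hst hτx hσx,
      exists_isThreeCycle_mem_closure_pair hst hτx hσx⟩
  | succ k hk ih =>
    have hk' := mono k (by omega)
    obtain ⟨S, U, W, O, h, hS, ρ, hρ, h3⟩ := ih (by
      have := mono (k - 1) (by omega)
      rw [Nat.sub_add_cancel (by omega)] at this
      omega) (fun i hi => mono i (by omega))
    obtain ⟨σ, U', W', O', h', -, hσ⟩ := h.step hA hA0 hk'
    -- The new petal moves `x` itself, so the fixed orbit point must be taken from an older petal.
    obtain ⟨z, hz, hzx⟩ := Finset.exists_mem_ne (s := O) (by have := h.card_O; omega) x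
    exact ⟨_, U', W', O', h', hS.insert (h.linked z hz) (hσ z (h.subset_U hz) hzx), ρ,
      Subgroup.closure_mono (Set.subset_insert _ _) hρ, h3⟩

/-- `i` permutations of type `A` whose nontrivial blocks through `x` are stable, with a large
orbit of `x`; the number of orbits is at most `max 1 (n - i * c A)`. -/
structure Stage (A : Multiset ℕ) (x : α) (i : ℕ) (S : Set (Perm α)) (W O : Finset α) :
    Prop where
  encard_le : S.encard ≤ i
  cycleType_eq : ∀ σ ∈ S, σ.cycleType = A
  mem_W : x ∈ W
  card_W : W.card ≤ max 1 (Fintype.card α - i * c A)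
  covers : Covers S W
  card_O : A.card + 1 ≤ O.card
  linked : ∀ o ∈ O, Linked S x o
  stabilizesBlocks : StabilizesBlocks S x
  isThreeCycle : ∃ ρ ∈ Subgroup.closure S, ρ.IsThreeCycle

/-- Each cycle starts at a point of `R` in the orbit of `x`, and the remaining places take
representatives of other orbits. The spare orbit point `z` stays fixed, hence the demand for `A.card
+ 1` points in `O`. -/
lemma Stage.step {A : Multiset ℕ} (hA : ∀ a ∈ A, 2 ≤ a) {x : α} {i : ℕ}
    {S : Set (Perm α)} {W O : Finset α} (h : Stage A x i S W O)
    (hn : c A + A.card + 1 ≤ Fintype.card α) :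
    ∃ S' W', Stage A x (i + 1) S' W' O := by
  classical
  have hO := h.card_O
  obtain ⟨R, hRO, hR⟩ := Finset.exists_subset_card_eq (s := O) (n := A.card) (by omega)
  obtain ⟨z, hzO, hzR⟩ : ∃ z ∈ O, z ∉ R := by
    by_contra! hcon
    have := Finset.card_le_card hcon
    omega
  -- a covering set that meets the orbit of `x` only in `x`
  set T₀ := {w ∈ W | ¬ Linked S x w} with hT₀
  have hxT₀ : x ∉ T₀ := by simp [hT₀, Linked.refl]
  have hcov : Covers S (insert x T₀) := by
    intro y
    obtain ⟨w, hw, hwy⟩ := h.covers y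
    by_cases hxw : Linked S x w
    · exact ⟨x, by simp, hxw.trans hwy⟩
    · exact ⟨w, by simp [hT₀, hw, hxw], hwy⟩
  have hcard : T₀.card + 1 ≤ W.card := by
    rw [← Finset.card_insert_of_notMem hxT₀]
    refine Finset.card_le_card (Finset.insert_subset h.mem_W (Finset.filter_subset _ _))
  obtain ⟨T, hTT₀, hT⟩ := Finset.exists_subset_card_eq (s := T₀) (n := min (c A) T₀.card)
    (min_le_right _ _)
  have hTl : ∀ t ∈ T, ¬ Linked S x t := fun t ht => (Finset.mem_filter.1 (hTT₀ ht)).2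
  -- If fewer than `c A` other orbits remain, arbitrary points avoiding `z` and `R` fill the places.
  obtain ⟨T', hTT', hT'R, hT'⟩ := Finset.exists_subsuperset_card_eq (s := T)
    (t := (insert z R)ᶜ) (n := c A) (by
      intro t ht
      rw [Finset.mem_compl, Finset.mem_insert, not_or]
      refine ⟨?_, fun htR => hTl t ht (h.linked t (hRO htR))⟩
      rintro rfl
      exact hTl _ ht (h.linked _ hzO))
    (by omega) (by rw [Finset.card_compl, Finset.card_insert_of_notMem hzR]; omega)
  have hT'R' : ∀ t ∈ T', t ≠ z ∧ t ∉ R := fun t ht => by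
    have := hT'R ht
    simpa using this
  obtain ⟨σ, hσ, hs, hl⟩ := exists_cycleType_eq hA (R := R) (T := T')
    (Finset.disjoint_left.2 fun y hy hy' => (hT'R' y hy').2 hy) hR hT'
  have hσz : σ z = z := by
    by_contra hne
    rw [← Ne, ← mem_support, hs, Finset.mem_union] at hne
    exact hne.elim hzR fun e => (hT'R' z e).1 rfl
  have hsub : S ⊆ insert σ S := Set.subset_insert _ _
  have hxT : x ∉ T := fun hx => hTl x hx (Linked.refl _ _)
  have hTsub : T ⊆ insert x T₀ := hTT₀.trans (Finset.subset_insert _ _)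
  refine ⟨insert σ S, insert x T₀ \ T, ?_, ?_, ?_, ?_, ?_, hO, ?_, ?_, ?_⟩
  · push_cast
    exact (Set.encard_insert_le _ _).trans (add_le_add_left h.encard_le 1)
  · rintro τ (rfl | hτ)
    · exact hσ
    · exact h.cycleType_eq τ hτ
  · simp [hxT]
  · have hW := h.card_W
    rw [Finset.card_sdiff_of_subset hTsub, Finset.card_insert_of_notMem hxT₀, hT, add_mul, one_mul]
    omega
  · refine hcov.insert_sdiff σ fun t ht => ?_
    obtain ⟨r, hr, hrt⟩ := hl t (hTT' ht)
    exact ⟨r, hrt, x, by simp [hxT], h.linked r (hRO hr)⟩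
  · exact fun o ho => (h.linked o ho).mono hsub
  · exact h.stabilizesBlocks.insert (h.linked z hzO) hσz
  · obtain ⟨ρ, hρ, h3⟩ := h.isThreeCycle
    exact ⟨ρ, Subgroup.closure_mono hsub hρ, h3⟩

lemma exists_generating_set {A : Multiset ℕ} (hA : ∀ a ∈ A, 2 ≤ a) (hA0 : A ≠ 0)
    (hodd : ∀ σ : Perm α, σ.cycleType = A → sign σ = -1)
    (hn : 2 * A.card * c A + 1 ≤ Fintype.card α) {d : ℕ}
    (hd : Fintype.card α ≤ d * c A + 1) :
    ∃ S : Set (Perm α), S.encard ≤ d ∧ (∀ σ ∈ S, σ.cycleType = A) ∧ Subgroup.closure S = ⊤ := by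
  have hm : 0 < A.card := Multiset.card_pos.2 hA0
  have hm' := card_le_c hA
  have hne : Nonempty α := Fintype.card_pos_iff.1 (by omega)
  obtain ⟨x⟩ := hne
  have h2 : 2 * c A ≤ 2 * A.card * c A := by nlinarith
  have hk : 2 * A.card ≤ d := by
    refine Nat.le_of_mul_le_mul_right (c := c A) ?_ (by omega)
    omega
  -- Two petals are needed for the three-cycle, and `A.card` petals to give `O` its `A.card + 1`
  -- points.
  have hflower : max 2 A.card * (c A + A.card) + 1 ≤ Fintype.card α + max 2 A.card := by
    rcases le_total 2 A.card with h | h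
    · rw [max_eq_right h]
      nlinarith
    · rw [max_eq_left h]
      rcases (show A.card = 1 ∨ A.card = 2 by omega) with e | e <;> rw [e] at hn ⊢ <;> omega
  obtain ⟨S₀, U, W₀, O, hF, hB, h3⟩ := exists_flower hA hA0 x (le_max_left 2 A.card) hflower
  have hstage₀ : Stage A x (max 2 A.card) S₀ W₀ O := by
    refine ⟨hF.encard_le, hF.cycleType_eq, hF.mem_W, ?_, hF.covers, ?_, hF.linked, hB, h3⟩
    · have := hF.card_W
      omega
    · have := hF.card_O
      omega
  have hstage : ∀ e, max 2 A.card ≤ e → ∃ S W, Stage A x e S W O := by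
    intro e he
    induction e, he using Nat.le_induction with
    | base => exact ⟨_, _, hstage₀⟩
    | succ e _ ih =>
      obtain ⟨S, W, h⟩ := ih
      exact h.step hA (by omega)
  obtain ⟨S, W, h⟩ := hstage d (by omega)
  have hW1 : W.card ≤ 1 := by
    have := h.card_W
    omega
  have hlink : ∀ y, Linked S x y := fun y => by
    obtain ⟨w, hw, hwy⟩ := h.covers y
    rwa [Finset.card_le_one.1 hW1 w hw x h.mem_W] at hwy
  refine ⟨S, h.encard_le, h.cycleType_eq, closure_eq_top hlink h.stabilizesBlocks
    h.isThreeCycle ?_⟩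
  have hSne : S.Nonempty := by
    rw [Set.nonempty_iff_ne_empty]
    rintro rfl
    obtain ⟨ρ, hρ, hρ3⟩ := h.isThreeCycle
    simp only [Subgroup.closure_empty, Subgroup.mem_bot] at hρ
    subst hρ
    simp [IsThreeCycle] at hρ3
  obtain ⟨σ, hσ⟩ := hSne
  exact ⟨σ, hσ, hodd σ (h.cycleType_eq σ hσ)⟩

end UpperBound

/-! ### Lower bound: counting edges of a connected graph -/

section LowerBound

variable {α : Type*} [Fintype α] [DecidableEq α]

lemma exists_edges_of_isCycle {σ : Perm α} (hσ : σ.IsCycle) :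
    ∃ E : Finset (Sym2 α), E.card ≤ c σ.cycleType ∧
      ∀ x, (SimpleGraph.fromEdgeSet (E : Set (Sym2 α))).Reachable x (σ x) := by
  obtain ⟨r, hr, -⟩ := id hσ
  -- Omit the edge leaving `r`; the rest of the cycle still leads from `σ r` back to `r`.
  refine ⟨(σ.support.erase r).image fun y => s(y, σ y), ?_, ?_⟩
  · refine Finset.card_image_le.trans ?_
    rw [Finset.card_erase_of_mem (mem_support.2 hr), hσ.cycleType]
    simp [c]
  · set G := SimpleGraph.fromEdgeSet
      (((σ.support.erase r).image fun y => s(y, σ y) : Finset (Sym2 α)) : Set (Sym2 α)) with hG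
    have hstep : ∀ y, y ≠ r → G.Reachable y (σ y) := by
      intro y hy
      by_cases hyσ : σ y = y
      · rw [hyσ]
      · refine SimpleGraph.Adj.reachable ?_
        rw [hG, SimpleGraph.fromEdgeSet_adj]
        refine ⟨?_, Ne.symm hyσ⟩
        rw [Finset.mem_coe, Finset.mem_image]
        exact ⟨y, by simp [hy, hyσ], rfl⟩
    have hpow : ∀ i : ℕ, G.Reachable (σ r) ((σ ^ i) (σ r)) := by
      intro i
      induction i with
      | zero => simp
      | succ i ih =>
        rw [pow_succ', Perm.mul_apply]
        by_cases h : (σ ^ i) (σ r) = r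
        · rw [h]
        · exact ih.trans (hstep _ h)
    intro y
    by_cases hy : y = r
    · subst hy
      have := hpow (orderOf σ - 1)
      rw [← Perm.mul_apply, ← pow_succ, Nat.sub_add_cancel (orderOf_pos σ), pow_orderOf_eq_one]
        at this
      exact this.symm
    · exact hstep y hy

lemma c_add (A B : Multiset ℕ) : c (A + B) = c A + c B := by
  simp [c]

lemma exists_edges (σ : Perm α) :
    ∃ E : Finset (Sym2 α), E.card ≤ c σ.cycleType ∧
      ∀ x, (SimpleGraph.fromEdgeSet (E : Set (Sym2 α))).Reachable x (σ x) := by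
  induction σ using cycle_induction_on with
  | base_one => exact ⟨∅, by simp, fun x => by simp⟩
  | base_cycles σ hσ => exact exists_edges_of_isCycle hσ
  | induction_disjoint σ τ hd _ h₁ h₂ =>
    obtain ⟨E, hE, hE'⟩ := h₁
    obtain ⟨F, hF, hF'⟩ := h₂
    refine ⟨E ∪ F, ?_, fun x => ?_⟩
    · rw [hd.cycleType_mul, c_add]
      exact (Finset.card_union_le _ _).trans (add_le_add hE hF)
    · exact ((hF' x).mono (SimpleGraph.fromEdgeSet_mono (by simp))).trans
        ((hE' (τ x)).mono (SimpleGraph.fromEdgeSet_mono (by simp)))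

lemma card_le_of_closure_eq_top [Nonempty α] {A : Multiset ℕ} (S : Finset (Perm α))
    (hA : ∀ σ ∈ S, σ.cycleType = A) (hS : Subgroup.closure (S : Set (Perm α)) = ⊤) :
    Fintype.card α ≤ S.card * c A + 1 := by
  choose E hE hE' using fun σ : Perm α => exists_edges σ
  set G := SimpleGraph.fromEdgeSet ((S.biUnion E : Finset (Sym2 α)) : Set (Sym2 α)) with hG
  have hreach : ∀ g : Perm α, ∀ x, G.Reachable x (g x) := by
    intro g
    have hg : g ∈ Subgroup.closure (S : Set (Perm α)) := by rw [hS]; trivial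
    refine Subgroup.closure_induction (p := fun g _ => ∀ x, G.Reachable x (g x)) ?_ ?_ ?_ ?_ hg
    · intro σ hσ x
      refine (hE' σ x).mono (SimpleGraph.fromEdgeSet_mono ?_)
      exact_mod_cast Finset.subset_biUnion_of_mem E hσ
    · exact fun x => SimpleGraph.Reachable.refl x
    · exact fun a b _ _ ha hb x => (hb x).trans (ha (b x))
    · intro a _ ha x
      have := ha (a⁻¹ x)
      rw [perm_apply_inv_self] at this
      exact this.symm
  have hconn : G.Connected := by
    refine ⟨fun x y => ?_⟩
    have := hreach (swap x y) x
    rwa [swap_apply_left] at this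
  have h₁ := hconn.card_vert_le_card_edgeSet_add_one
  rw [Nat.card_eq_fintype_card] at h₁
  have h₂ : Nat.card G.edgeSet ≤ (S.biUnion E).card := by
    rw [Nat.card_coe_set_eq, ← Set.ncard_coe_finset]
    refine Set.ncard_le_ncard ?_ (Finset.finite_toSet _)
    rw [hG, SimpleGraph.edgeSet_fromEdgeSet]
    exact Set.sdiff_subset
  have h₃ : (S.biUnion E).card ≤ S.card * c A :=
    Finset.card_biUnion_le_card_mul _ _ _ fun σ hσ => (hE σ).trans_eq (by rw [hA σ hσ])
  omega

end LowerBound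

/-! ### The formula for `f` and the explicit thresholds -/

lemma IsOddType.ne_zero {A : Multiset ℕ} (h : IsOddType A) : A ≠ 0 := by
  rintro rfl
  have := h.2 0 1 (by simp [extClass])
  simp at this

lemma f_eq {A : Multiset ℕ} (hA : IsOddType A) {n : ℕ} (hn : 2 * A.card * c A + 1 ≤ n) :
    f A n = ((⌈((n : ℚ) - 1) / (c A : ℚ)⌉₊ : ℕ) : ℕ∞) := by
  have hm : 0 < A.card := Multiset.card_pos.2 hA.ne_zero
  have hc : (0 : ℚ) < c A := by
    have := card_le_c hA.1
    exact_mod_cast (show 0 < c A by omega)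
  refine le_antisymm ?_ ?_
  · have hd := Nat.le_ceil (((n : ℚ) - 1) / (c A : ℚ))
    rw [div_le_iff₀ hc] at hd
    obtain ⟨S, hS, hS', hS''⟩ := exists_generating_set (α := Fin n) hA.1 hA.ne_zero
      (fun σ hσ => hA.2 n σ hσ) (by simpa using hn)
      (d := ⌈((n : ℚ) - 1) / (c A : ℚ)⌉₊) (by
        rw [Fintype.card_fin]
        rw [sub_le_iff_le_add] at hd
        exact_mod_cast hd)
    exact (iInf₂_le S ⟨hS', hS''⟩).trans hS
  · refine le_iInf₂ fun S hS => ?_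
    have : Nonempty (Fin n) := ⟨⟨0, by omega⟩⟩
    have hfin : S.Finite := Set.toFinite S
    have h := card_le_of_closure_eq_top (A := A) hfin.toFinset
      (fun σ hσ => hS.1 (hfin.mem_toFinset.1 hσ)) (by simpa using hS.2)
    rw [hfin.encard_eq_coe_toFinset_card]
    rw [Nat.cast_le, Nat.ceil_le, div_le_iff₀ hc, sub_le_iff_le_add]
    rw [Fintype.card_fin] at h
    exact_mod_cast h

/-- For `m > 1` the value exceeds `(2m - 1) ^ φ(2m) ≥ 2m - 1`, and it is an integer. -/
lemma two_mul_le_cyclotomic_eval {m : ℕ} (hm : 0 < m) :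
    2 * (m : ℤ) ≤ (Polynomial.cyclotomic (2 * m) ℤ).eval (2 * (m : ℤ)) := by
  rcases Nat.eq_or_lt_of_le (Nat.succ_le_of_lt hm) with rfl | hm
  · simp [Polynomial.cyclotomic_two]
  have h := Polynomial.sub_one_pow_totient_lt_cyclotomic_eval (n := 2 * m) (q := 2 * (m : ℝ))
    (by omega) (by norm_cast; omega)
  have hφ : (2 * (m : ℝ) - 1) ≤ (2 * (m : ℝ) - 1) ^ (2 * m).totient := by
    refine le_self_pow₀ ?_ (Nat.totient_pos.2 (by omega)).ne'
    have : (1 : ℝ) ≤ m := by exact_mod_cast hm.le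
    linarith
  have e : (Polynomial.cyclotomic (2 * m) ℝ).eval (2 * (m : ℝ)) =
      (((Polynomial.cyclotomic (2 * m) ℤ).eval (2 * (m : ℤ)) : ℤ) : ℝ) := by
    rw [← Polynomial.map_cyclotomic_int (2 * m) ℝ]
    have := Polynomial.eval_intCast_map (Int.castRingHom ℝ)
      (Polynomial.cyclotomic (2 * m) ℤ) (2 * (m : ℤ))
    push_cast at this
    simpa using this
  rw [e] at h
  have h' : ((2 * (m : ℤ) - 1 : ℤ) : ℝ) <
      (((Polynomial.cyclotomic (2 * m) ℤ).eval (2 * (m : ℤ)) : ℤ) : ℝ) := by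
    push_cast
    linarith
  have := Int.cast_lt.1 h'
  linarith

end ConjGen

theorem mainTheorem1 :
    ∃ X₀ : Multiset ℕ → ℕ,
      (∀ A : Multiset ℕ, ConjGen.IsOddType A → ∀ n : ℕ, X₀ A ≤ n →
        ConjGen.f A n = ((⌈((n : ℚ) - 1) / (ConjGen.c A : ℚ)⌉₊ : ℕ) : ℕ∞)) ∧
      (∀ k : ℕ, ConjGen.IsOddType {k} → X₀ {k} ≤ 2 * k - 1) ∧
      (∀ k : ℕ, ConjGen.IsOddType (ConjGen.B k) →
        X₀ (ConjGen.B k) ≤ (2 * k + 1).choose 2 + 1) ∧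
      (∀ A : Multiset ℕ, ConjGen.IsOddType A →
        (X₀ A : ℤ) ≤ (ConjGen.c A : ℤ) *
          (Polynomial.cyclotomic (2 * A.card) ℤ).eval (2 * (A.card : ℤ)) + 1) := by
  -- The values are exactly `2k - 1` for `(k)` and `2k² + 1 ≤ k(2k + 1) + 1` for `B k`.
  refine ⟨fun A => 2 * A.card * ConjGen.c A + 1, fun A hA n hn => ConjGen.f_eq hA hn, ?_, ?_, ?_⟩
  · intro k hk
    have := hk.1 k (by simp)
    simp only [Multiset.card_singleton, ConjGen.c, Multiset.map_singleton, Multiset.sum_singleton]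
    omega
  · intro k _
    have h₁ : (2 * k + 1).choose 2 = k * (2 * k + 1) := by
      rw [Nat.choose_two_right, Nat.add_sub_cancel, show (2 * k + 1) * (2 * k) =
        2 * (k * (2 * k + 1)) by ring, Nat.mul_div_cancel_left _ (by norm_num)]
    simp only [ConjGen.B, ConjGen.c, Multiset.card_replicate, Multiset.map_replicate,
      Multiset.sum_replicate, h₁, smul_eq_mul]
    nlinarith
  · intro A hA
    have h := ConjGen.two_mul_le_cyclotomic_eval (Multiset.card_pos.2 hA.ne_zero)
    have h₂ := mul_le_mul_of_nonneg_left h (Int.natCast_nonneg (ConjGen.c A))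
    push_cast
    linarith
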